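/- Let $\kappa\ge 1$ and $d\ge 0$ be integers and let $(M^d,g)$ be a smooth $d$-dimensional Riemannian manifold that is complete for its Riemannian distance. Let $V:\mathbb{R}^d\to\Gamma(TM)$, $a\mapsto V_a$, be a linear map into the smooth vector fields on $M$ such that $g(V_a(m),V_b(m))=a\cdot b$ for all $a,b\in\mathbb{R}^d$ and $m\in M$, and let $Q(a,b)\in C^\infty(M,\mathbb{R}^d)$ be determined by $[V_a,V_b]=V_{Q(a,b)}$, i.e. $[V_a,V_b](m)=V_{Q(a,b)(m)}(m)$. Suppose that for all $0\le k\le\kappa-1$ and all $a,b,a_1,\dots,a_k\in\mathbb{R}^d$ the function $V_{a_1}\cdots V_{a_k}Q(a,b):M\to\mathbb{R}^d$ is bounded (for $k=0$: $Q(a,b)$ is bounded). Let $F^{(\kappa)}(\mathbb{R}^d)$ be the Lie subalgebra generated by $\mathbb{R}^d$ of the truncated tensor algebra $\bigoplus_{k=0}^{\kappa}(\mathbb{R}^d)^{\otimes k}$ with the commutator bracket (tensors of degree $>\kappa$ are discarded), with the Hilbert norm $|\cdot|$ induced by the dot product, and let $A\mapsto V_A$ be the unique linear map $F^{(\kappa)}(\mathbb{R}^d)\to\Gamma(TM)$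 with $V_A=[V_{w_1},[V_{w_2},\dots,[V_{w_{j-1}},V_{w_j}]]]$ whenever $A=[w_1,[w_2,\dots,[w_{j-1},w_j]]]$, $1\le j\le\kappa$, $w_i\in\mathbb{R}^d$. Then $V$ satisfies the hypotheses of the global existence theorem for rough differential equations: $g$ is complete and, with $\nabla$ the Levi-Civita covariant derivative, $$\sup_{A\in F^{(\kappa)}(\mathbb{R}^d),\,|A|=1}\ \sup_{m\in M}|V_A(m)|_g\;+\;\sup_{A\in F^{(\kappa)}(\mathbb{R}^d),\,|A|=1}\ \sup_{m\in M}\ \sup_{v\in T_mM,\,|v|_g=1}|\nabla_vV_A|_g\;<\;\infty .$$ -/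

import Mathlib

open scoped Manifold ContDiff Bundle

noncomputable section

namespace RoughFlow

/-! ### The step-`κ` free nilpotent Lie algebra inside the tensor algebra -/

section Algebra

/-- The right-nested bracket `[f w₁, [f w₂, … [f wₙ, f u]]]`, i.e. `ad_{f w₁} ⋯ ad_{f wₙ} (f u)`,
for the list `l = [w₁, …, wₙ]`. -/
def nestedBracket {W L : Type*} [Bracket L L] (f : W → L) (l : List W) (u : W) : L :=
  l.foldr (fun w x => ⁅f w, x⁆) (f u)

/-- In any Lie algebra, brackets of right-nested brackets are combinations of right-nested ones. -/
lemma lie_nestedBracket_mem_span {W L : Type*} [LieRing L] [LieAlgebra ℝ L] (f : W → L)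
    (l l' : List W) (u u' : W) :
    ⁅nestedBracket f l u, nestedBracket f l' u'⁆ ∈ Submodule.span ℝ
      {x | ∃ (p : List W) (v : W), p.length = l.length + l'.length + 1 ∧ x = nestedBracket f p v} := by
  induction l generalizing l' u' with
  | nil => exact Submodule.subset_span ⟨u :: l', u', by simp, rfl⟩
  | cons w l ih =>
    have h1 : nestedBracket f (w :: l) u = ⁅f w, nestedBracket f l u⁆ := rfl
    rw [h1, lie_lie]
    refine Submodule.sub_mem _ ?_ ?_
    · have := Submodule.mem_map_of_mem (f := (LieAlgebra.ad ℝ L (f w) : L →ₗ[ℝ] L)) (ih l' u')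
      rw [Submodule.map_span] at this
      refine Submodule.span_mono ?_ this
      rintro _ ⟨_, ⟨p, v, hp, rfl⟩, rfl⟩
      exact ⟨w :: p, v, by simp [hp]; omega, rfl⟩
    · have := ih (w :: l') u'
      refine Submodule.span_mono ?_ this
      rintro _ ⟨p, v, hp, rfl⟩
      exact ⟨p, v, by simp [hp]; omega, rfl⟩

variable (W : Type*) [AddCommGroup W] [Module ℝ W]

/-- The degree `k` part `W^{⊗k}` of the tensor algebra `T(W)`. -/
abbrev tensorDegree (k : ℕ) : Submodule ℝ (TensorAlgebra ℝ W) :=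
  LinearMap.range (TensorAlgebra.ι ℝ : W →ₗ[ℝ] TensorAlgebra ℝ W) ^ k

/-- The projection `π_{≤κ}` of `T(W)` onto `⨁_{k ≤ κ} W^{⊗k}`. -/
def tensorTruncation (κ : ℕ) : TensorAlgebra ℝ W →ₗ[ℝ] TensorAlgebra ℝ W :=
  ∑ k ∈ Finset.range (κ + 1), GradedAlgebra.proj (tensorDegree W) k

/-- The step-`κ` free nilpotent Lie algebra over `W`: the Lie subalgebra generated by `W` of the
truncated tensor algebra `⨁_{k ≤ κ} W^{⊗k}` with the bracket `[A, B] = π_{≤κ}(AB - BA)`. -/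
def freeNilpotentLie (κ : ℕ) : Submodule ℝ (TensorAlgebra ℝ W) :=
  sInf {S | (∀ w : W, tensorTruncation W κ (TensorAlgebra.ι ℝ w) ∈ S) ∧
    ∀ A ∈ S, ∀ B ∈ S, tensorTruncation W κ (A * B - B * A) ∈ S}

variable {W}

lemma tensorProj_of_mem {k j : ℕ} {A : TensorAlgebra ℝ W} (hA : A ∈ tensorDegree W j) :
    GradedAlgebra.proj (tensorDegree W) k A = if k = j then A else 0 := by
  rw [GradedAlgebra.proj_apply]
  split_ifs with h
  · subst h; exact DirectSum.decompose_of_mem_same _ hA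
  · exact DirectSum.decompose_of_mem_ne _ hA (Ne.symm h)

lemma tensorTruncation_of_mem {κ j : ℕ} {A : TensorAlgebra ℝ W} (hA : A ∈ tensorDegree W j) :
    tensorTruncation W κ A = if j ≤ κ then A else 0 := by
  simp [tensorTruncation, LinearMap.sum_apply, tensorProj_of_mem hA, Finset.sum_ite_eq']

lemma ι_mem_tensorDegree (w : W) : TensorAlgebra.ι ℝ w ∈ tensorDegree W 1 := by
  simp [tensorDegree]

lemma nestedBracket_mem_tensorDegree (l : List W) (u : W) :
    nestedBracket (TensorAlgebra.ι ℝ) l u ∈ tensorDegree W (l.length + 1) := by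
  induction l with
  | nil => exact ι_mem_tensorDegree u
  | cons w l ih =>
    have h1 : nestedBracket (TensorAlgebra.ι ℝ) (w :: l) u
        = TensorAlgebra.ι ℝ w * nestedBracket (TensorAlgebra.ι ℝ) l u
          - nestedBracket (TensorAlgebra.ι ℝ) l u * TensorAlgebra.ι ℝ w := rfl
    rw [h1]
    refine Submodule.sub_mem _ ?_ ?_
    · have := SetLike.mul_mem_graded (A := tensorDegree W) (ι_mem_tensorDegree w) ih
      rwa [show 1 + (l.length + 1) = (w :: l).length + 1 by simp; omega] at this
    · have := SetLike.mul_mem_graded (A := tensorDegree W) ih (ι_mem_tensorDegree w)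
      rwa [show (l.length + 1) + 1 = (w :: l).length + 1 by simp] at this

lemma nestedBracket_mem {κ : ℕ} (l : List W) (u : W) (hl : l.length + 1 ≤ κ) :
    nestedBracket (TensorAlgebra.ι ℝ) l u ∈ freeNilpotentLie W κ := by
  refine Submodule.mem_sInf.2 fun S hS => ?_
  induction l with
  | nil =>
    have := hS.1 u
    rwa [tensorTruncation_of_mem (ι_mem_tensorDegree u), if_pos (by simpa using hl)] at this
  | cons w l ih =>
    have hw := hS.1 w
    rw [tensorTruncation_of_mem (ι_mem_tensorDegree w), if_pos (by simp at hl; omega)] at hw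
    have := hS.2 _ hw _ (ih (by simp at hl; omega))
    have h1 : TensorAlgebra.ι ℝ w * nestedBracket (TensorAlgebra.ι ℝ) l u
          - nestedBracket (TensorAlgebra.ι ℝ) l u * TensorAlgebra.ι ℝ w
          = nestedBracket (TensorAlgebra.ι ℝ) (w :: l) u := rfl
    rwa [h1, tensorTruncation_of_mem (nestedBracket_mem_tensorDegree (w :: l) u),
      if_pos hl] at this

attribute [local instance 100] LieRing.ofAssociativeRing LieAlgebra.ofAssociativeAlgebra in
lemma freeNilpotentLie_le_span (κ : ℕ) : freeNilpotentLie W κ ≤ Submodule.span ℝ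
    {A | ∃ (l : List W) (u : W), l.length + 1 ≤ κ ∧ A = nestedBracket (TensorAlgebra.ι ℝ) l u} := by
  refine sInf_le ⟨fun w => ?_, fun A hA B hB => ?_⟩
  · rw [tensorTruncation_of_mem (ι_mem_tensorDegree w)]
    split_ifs with h
    · exact Submodule.subset_span ⟨[], w, by simpa using h, rfl⟩
    · exact Submodule.zero_mem _
  · change tensorTruncation W κ ⁅A, B⁆ ∈ _
    induction hA using Submodule.span_induction with
    | zero => simp
    | add x y _ _ hx hy => rw [add_lie, map_add]; exact Submodule.add_mem _ hx hy
    | smul c x _ hx => rw [smul_lie, map_smul]; exact Submodule.smul_mem _ _ hx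
    | mem x hx =>
      induction hB using Submodule.span_induction with
      | zero => simp
      | add x y _ _ hx hy => rw [lie_add, map_add]; exact Submodule.add_mem _ hx hy
      | smul c x _ hx => rw [lie_smul, map_smul]; exact Submodule.smul_mem _ _ hx
      | mem y hy =>
        obtain ⟨l, u, -, rfl⟩ := hx
        obtain ⟨l', u', -, rfl⟩ := hy
        have := Submodule.mem_map_of_mem (f := tensorTruncation W κ)
          (lie_nestedBracket_mem_span (TensorAlgebra.ι ℝ) l l' u u')
        rw [Submodule.map_span] at this
        refine Submodule.span_le.2 ?_ this
        rintro _ ⟨_, ⟨p, v, -, rfl⟩, rfl⟩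
        rw [tensorTruncation_of_mem (nestedBracket_mem_tensorDegree p v)]
        split_ifs with h
        · exact Submodule.subset_span ⟨p, v, h, rfl⟩
        · exact Submodule.zero_mem _

variable {L : Type*} [LieRing L] [LieAlgebra ℝ L]

/-- Auxiliary action of `W` on `L × ℝ`: `w · (x, c) = ([f w, x] + c f w, 0)`. -/
def bracketAction (f : W →ₗ[ℝ] L) : W →ₗ[ℝ] Module.End ℝ (L × ℝ) where
  toFun w :=
    { toFun := fun p => (⁅f w, p.1⁆ + p.2 • f w, 0)
      map_add' := fun p q => by simp [add_smul]; abel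
      map_smul' := fun c p => by simp [mul_smul] }
  map_add' w w' := by ext <;> simp
  map_smul' c w := by ext <;> simp

lemma bracketAction_nested (f : W →ₗ[ℝ] L) (l : List W) (u : W) :
    (∀ x : L, TensorAlgebra.lift ℝ (bracketAction f) (nestedBracket (TensorAlgebra.ι ℝ) l u) (x, 0)
      = (⁅nestedBracket f l u, x⁆, 0)) ∧
    TensorAlgebra.lift ℝ (bracketAction f) (nestedBracket (TensorAlgebra.ι ℝ) l u) (0, 1)
      = (((l.length + 1 : ℕ) : ℝ) • nestedBracket f l u, 0) := by
  induction l with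
  | nil => simp [nestedBracket, bracketAction]
  | cons w l ih =>
    have h1 : nestedBracket (TensorAlgebra.ι ℝ) (w :: l) u
        = TensorAlgebra.ι ℝ w * nestedBracket (TensorAlgebra.ι ℝ) l u
          - nestedBracket (TensorAlgebra.ι ℝ) l u * TensorAlgebra.ι ℝ w := rfl
    have h2 : nestedBracket f (w :: l) u = ⁅f w, nestedBracket f l u⁆ := rfl
    have h3 : ∀ p : L × ℝ, bracketAction f w p = (⁅f w, p.1⁆ + p.2 • f w, 0) := fun _ => rfl
    rw [h1, h2]
    constructor
    · intro x
      simp only [map_sub, map_mul, TensorAlgebra.lift_ι_apply, LinearMap.sub_apply,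
        Module.End.mul_apply, h3, ih.1]
      simp
    · simp only [map_sub, map_mul, TensorAlgebra.lift_ι_apply, LinearMap.sub_apply,
        Module.End.mul_apply, h3, ih.1, ih.2]
      simp only [zero_smul, add_zero, one_smul, lie_zero, zero_add, Prod.mk_sub_mk, sub_zero,
        lie_smul, List.length_cons]
      rw [← lie_skew (nestedBracket f l u) (f w), sub_neg_eq_add]
      refine Prod.ext ?_ rfl
      push_cast
      module

/-- A linear map `f` from `W` to a Lie algebra has one and only one linear extension to the
step-`κ` free nilpotent Lie algebra that maps `ad_{w₁} ⋯ ad_{w_{j-1}} w_j` to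
`ad_{f w₁} ⋯ ad_{f w_{j-1}} (f w_j)` whenever `1 ≤ j ≤ κ`. -/
theorem existsUnique_nilpotentExtension (κ : ℕ) (f : W →ₗ[ℝ] L) :
    ∃! Φ : freeNilpotentLie W κ →ₗ[ℝ] L, ∀ (l : List W) (u : W) (hl : l.length + 1 ≤ κ),
      Φ ⟨nestedBracket (TensorAlgebra.ι ℝ) l u, nestedBracket_mem l u hl⟩ = nestedBracket f l u := by
  let r : TensorAlgebra ℝ W →ₗ[ℝ] L := (LinearMap.fst ℝ L ℝ ∘ₗ LinearMap.applyₗ ((0, 1) : L × ℝ)) ∘ₗ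
    (TensorAlgebra.lift ℝ (bracketAction f)).toLinearMap
  have hr : ∀ l u, r (nestedBracket (TensorAlgebra.ι ℝ) l u)
      = ((l.length + 1 : ℕ) : ℝ) • nestedBracket f l u := by
    intro l u
    simp only [r, LinearMap.comp_apply, LinearMap.applyₗ_apply_apply, AlgHom.toLinearMap_apply,
      (bracketAction_nested f l u).2, LinearMap.fst_apply]
  let Ψ : TensorAlgebra ℝ W →ₗ[ℝ] L := ∑ k ∈ Finset.Icc 1 κ,
    (k : ℝ)⁻¹ • (r ∘ₗ GradedAlgebra.proj (tensorDegree W) k)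
  refine ⟨Ψ.domRestrict _, fun l u hl => ?_, fun Φ hΦ => ?_⟩
  · simp only [LinearMap.domRestrict_apply, Ψ, LinearMap.sum_apply, LinearMap.smul_apply,
      LinearMap.comp_apply, tensorProj_of_mem (nestedBracket_mem_tensorDegree l u)]
    rw [Finset.sum_eq_single (l.length + 1)]
    · rw [if_pos rfl, hr, smul_smul, inv_mul_cancel₀ (by positivity), one_smul]
    · intro b _ hb
      simp [hb]
    · intro h
      exact absurd (Finset.mem_Icc.2 ⟨by omega, hl⟩) h
  · have key : ∀ A (_ : A ∈ Submodule.span ℝ {A | ∃ (l : List W) (u : W), l.length + 1 ≤ κ ∧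
        A = nestedBracket (TensorAlgebra.ι ℝ) l u}),
        ∀ hA : A ∈ freeNilpotentLie W κ, Φ ⟨A, hA⟩ = Ψ A := by
      intro A hA
      have hle : Submodule.span ℝ {A | ∃ (l : List W) (u : W), l.length + 1 ≤ κ ∧
        A = nestedBracket (TensorAlgebra.ι ℝ) l u} ≤ freeNilpotentLie W κ := by
        refine Submodule.span_le.2 ?_
        rintro _ ⟨l, u, hl, rfl⟩
        exact nestedBracket_mem l u hl
      induction hA using Submodule.span_induction with
      | zero => intro h; rw [map_zero]; exact map_zero Φ
      | add x y hx hy ihx ihy =>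
        intro h
        rw [map_add, ← ihx (hle hx), ← ihy (hle hy), ← map_add]; rfl
      | smul c x hx ihx =>
        intro h
        rw [map_smul, ← ihx (hle hx), ← map_smul]; rfl
      | mem x hx =>
        obtain ⟨l, u, hl, rfl⟩ := hx
        intro h
        rw [hΦ l u hl]
        simp only [Ψ, LinearMap.sum_apply, LinearMap.smul_apply,
          LinearMap.comp_apply, tensorProj_of_mem (nestedBracket_mem_tensorDegree l u)]
        rw [Finset.sum_eq_single (l.length + 1)]
        · rw [if_pos rfl, hr, smul_smul, inv_mul_cancel₀ (by positivity), one_smul]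
        · intro b _ hb
          simp [hb]
        · intro h
          exact absurd (Finset.mem_Icc.2 ⟨by omega, hl⟩) h
    ext A
    exact key A (freeNilpotentLie_le_span κ A.2) A.2

/-- The unique linear extension of `f : W → L` to the step-`κ` free nilpotent Lie algebra that
maps `ad_{w₁} ⋯ ad_{w_{j-1}} w_j` to `ad_{f w₁} ⋯ ad_{f w_{j-1}} (f w_j)` for `1 ≤ j ≤ κ`. -/
def nilpotentExtension (κ : ℕ) (f : W →ₗ[ℝ] L) : freeNilpotentLie W κ →ₗ[ℝ] L :=
  (existsUnique_nilpotentExtension κ f).choose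

lemma nilpotentExtension_nestedBracket (κ : ℕ) (f : W →ₗ[ℝ] L) (l : List W) (u : W)
    (hl : l.length + 1 ≤ κ) :
    nilpotentExtension κ f ⟨nestedBracket (TensorAlgebra.ι ℝ) l u, nestedBracket_mem l u hl⟩
      = nestedBracket f l u :=
  (existsUnique_nilpotentExtension κ f).choose_spec.1 l u hl

/-- The Hilbert norm on `T(ℝᵈ)` induced by the dot product of `ℝᵈ`: the tensors
`e_{i₁} ⊗ ⋯ ⊗ e_{iₖ}` (`k ≥ 0`) built from the standard basis of `ℝᵈ` are orthonormal. -/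
def tensorNorm {d : ℕ} (A : TensorAlgebra ℝ (EuclideanSpace ℝ (Fin d))) : ℝ :=
  √(((EuclideanSpace.basisFun (Fin d) ℝ).toBasis.tensorAlgebra.repr A).sum fun _ c => c ^ 2)

end Algebra

/-! ### Vector fields and the Levi-Civita covariant derivative -/

section Manifold

variable {E : Type*} [NormedAddCommGroup E] [NormedSpace ℝ E] [FiniteDimensional ℝ E]
  {H : Type*} [TopologicalSpace H] {I : ModelWithCorners ℝ E H}
  {M : Type*} [TopologicalSpace M] [ChartedSpace H M] [IsManifold I ∞ M]

open VectorField

lemma contMDiff_mlieBracket (X Y : Cₛ^∞⟮I; E, fun x : M => TangentSpace I x⟯) :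
    ContMDiff I I.tangent ∞ (fun x => (⟨x, mlieBracket I X Y x⟩ : TangentBundle I M)) := by
  have : CompleteSpace E := FiniteDimensional.complete ℝ E
  have : IsManifold I (((⊤ : ℕ∞) : ℕ∞ω) + 1) M := inferInstanceAs (IsManifold I ∞ M)
  have : IsManifold I (minSmoothness ℝ 2) M := by
    simp only [minSmoothness_of_isRCLikeNormedField]; infer_instance
  refine ContDiff.mlieBracket_vectorField (m := ⊤) (n := ⊤) X.contMDiff Y.contMDiff ?_
  simp

/-- The Lie algebra `Γ(TM)` of smooth vector fields: the bracket `[X, Y] = L_X Y`. -/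
instance instLieRingVectorField : LieRing (Cₛ^∞⟮I; E, fun x : M => TangentSpace I x⟯) where
  bracket X Y := ⟨mlieBracket I X Y, contMDiff_mlieBracket X Y⟩
  add_lie X Y Z := by
    have : CompleteSpace E := FiniteDimensional.complete ℝ E
    ext x
    exact mlieBracket_add_left X.mdifferentiableAt Y.mdifferentiableAt
  lie_add X Y Z := by
    have : CompleteSpace E := FiniteDimensional.complete ℝ E
    ext x
    exact mlieBracket_add_right Y.mdifferentiableAt Z.mdifferentiableAt
  lie_self X := by
    ext x
    exact congrFun (mlieBracket_self (I := I) (V := X)) x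
  leibniz_lie X Y Z := by
    have : CompleteSpace E := FiniteDimensional.complete ℝ E
    have : IsManifold I (minSmoothness ℝ 3) M := by
      simp only [minSmoothness_of_isRCLikeNormedField]; infer_instance
    have h : minSmoothness ℝ 2 ≤ ∞ := by
      simp only [minSmoothness_of_isRCLikeNormedField]
      exact WithTop.coe_le_coe.2 (le_top : (2 : ℕ∞) ≤ ⊤)
    ext x
    exact leibniz_identity_mlieBracket_apply (X.contMDiff.contMDiffAt.of_le h)
      (Y.contMDiff.contMDiffAt.of_le h) (Z.contMDiff.contMDiffAt.of_le h)

instance instLieAlgebraVectorField :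
    LieAlgebra ℝ (Cₛ^∞⟮I; E, fun x : M => TangentSpace I x⟯) where
  lie_smul c X Y := by
    have : CompleteSpace E := FiniteDimensional.complete ℝ E
    ext x
    exact mlieBracket_const_smul_right Y.mdifferentiableAt

lemma bracket_apply (X Y : Cₛ^∞⟮I; E, fun x : M => TangentSpace I x⟯) (x : M) :
    ⁅X, Y⁆ x = mlieBracket I X Y x := rfl

variable [Bundle.RiemannianBundle (fun x : M => TangentSpace I x)]

local notation "⟪" X ", " Y "⟫" => fun x => inner ℝ (X x) (Y x)

/-- The right-hand side of the Koszul formula for `2 g(∇_X Y, Z)`. -/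
def koszul (X Y Z : Π x : M, TangentSpace I x) (x : M) : ℝ :=
  mvfderiv I ⟪Y, Z⟫ x (X x) + mvfderiv I ⟪X, Z⟫ x (Y x) - mvfderiv I ⟪X, Y⟫ x (Z x)
    + inner ℝ (mlieBracket I X Y x) (Z x) - inner ℝ (mlieBracket I X Z x) (Y x)
    - inner ℝ (mlieBracket I Y Z x) (X x)

variable [IsContMDiffRiemannianBundle I ∞ E (fun x : M => TangentSpace I x)]

lemma mdifferentiableAt_inner {X Y : Π x : M, TangentSpace I x} {x : M}
    (hX : MDifferentiableAt I I.tangent (fun x => (⟨x, X x⟩ : TangentBundle I M)) x)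
    (hY : MDifferentiableAt I I.tangent (fun x => (⟨x, Y x⟩ : TangentBundle I M)) x) :
    MDifferentiableAt I 𝓘(ℝ, ℝ) ⟪X, Y⟫ x :=
  MDifferentiableAt.inner_bundle (IB := I) (F := E) (E := fun x : M => TangentSpace I x)
    (b := fun m : M => m) hX hY

lemma koszul_tensorial₁ {Y Z : Π x : M, TangentSpace I x} {x : M}
    (hY : MDifferentiableAt I I.tangent (fun x => (⟨x, Y x⟩ : TangentBundle I M)) x)
    (hZ : MDifferentiableAt I I.tangent (fun x => (⟨x, Z x⟩ : TangentBundle I M)) x) :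
    TensorialAt I E (fun X => koszul X Y Z x) x where
  smul {f X} hf hX := by
    have : CompleteSpace E := FiniteDimensional.complete ℝ E
    have h1 : ⟪f • X, Z⟫ = fun x => f x * ⟪X, Z⟫ x := by ext; simp [inner_smul_left]
    have h2 : ⟪f • X, Y⟫ = fun x => f x * ⟪X, Y⟫ x := by ext; simp [inner_smul_left]
    simp only [koszul]
    rw [h1, h2, mvfderiv_fun_mul hf (mdifferentiableAt_inner hX hZ), mvfderiv_fun_mul hf (mdifferentiableAt_inner hX hY),
      mlieBracket_smul_left hf hX, mlieBracket_smul_left hf hX]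
    simp [inner_add_left, inner_smul_left, inner_smul_right]
    ring
  add {X X'} hX hX' := by
    have : CompleteSpace E := FiniteDimensional.complete ℝ E
    have h1 : ⟪X + X', Z⟫ = fun x => ⟪X, Z⟫ x + ⟪X', Z⟫ x := by ext; simp [inner_add_left]
    have h2 : ⟪X + X', Y⟫ = fun x => ⟪X, Y⟫ x + ⟪X', Y⟫ x := by ext; simp [inner_add_left]
    simp only [koszul]
    rw [h1, h2, mvfderiv_fun_add (mdifferentiableAt_inner hX hZ) (mdifferentiableAt_inner hX' hZ),
      mvfderiv_fun_add (mdifferentiableAt_inner hX hY) (mdifferentiableAt_inner hX' hY),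
      mlieBracket_add_left hX hX', mlieBracket_add_left hX hX']
    simp [inner_add_left, inner_add_right]
    ring

lemma koszul_tensorial₂ {X Y : Π x : M, TangentSpace I x} {x : M}
    (hX : MDifferentiableAt I I.tangent (fun x => (⟨x, X x⟩ : TangentBundle I M)) x)
    (hY : MDifferentiableAt I I.tangent (fun x => (⟨x, Y x⟩ : TangentBundle I M)) x) :
    TensorialAt I E (fun Z => koszul X Y Z x) x where
  smul {f Z} hf hZ := by
    have : CompleteSpace E := FiniteDimensional.complete ℝ E
    have h1 : ⟪Y, f • Z⟫ = fun x => f x * ⟪Y, Z⟫ x := by ext; simp [inner_smul_right]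
    have h2 : ⟪X, f • Z⟫ = fun x => f x * ⟪X, Z⟫ x := by ext; simp [inner_smul_right]
    simp only [koszul]
    rw [h1, h2, mvfderiv_fun_mul hf (mdifferentiableAt_inner hY hZ), mvfderiv_fun_mul hf (mdifferentiableAt_inner hX hZ),
      mlieBracket_smul_right hf hZ, mlieBracket_smul_right hf hZ]
    simp [inner_add_left, inner_smul_left, inner_smul_right, real_inner_comm]
    ring
  add {Z Z'} hZ hZ' := by
    have : CompleteSpace E := FiniteDimensional.complete ℝ E
    have h1 : ⟪Y, Z + Z'⟫ = fun x => ⟪Y, Z⟫ x + ⟪Y, Z'⟫ x := by ext; simp [inner_add_right]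
    have h2 : ⟪X, Z + Z'⟫ = fun x => ⟪X, Z⟫ x + ⟪X, Z'⟫ x := by ext; simp [inner_add_right]
    simp only [koszul]
    rw [h1, h2, mvfderiv_fun_add (mdifferentiableAt_inner hY hZ) (mdifferentiableAt_inner hY hZ'),
      mvfderiv_fun_add (mdifferentiableAt_inner hX hZ) (mdifferentiableAt_inner hX hZ'),
      mlieBracket_add_right hZ hZ', mlieBracket_add_right hZ hZ']
    simp [inner_add_left, inner_add_right]
    ring

lemma mdifferentiableAt_extend_tangent {x : M} (v : TangentSpace I x) :
    MDifferentiableAt I I.tangent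
      (fun y => (⟨y, FiberBundle.extend E v y⟩ : TangentBundle I M)) x :=
  FiberBundle.mdifferentiableAt_extend I E v

instance instFiniteDimensionalTangent (x : M) : FiniteDimensional ℝ (TangentSpace I x) :=
  inferInstanceAs (FiniteDimensional ℝ E)

open Classical in
/-- The value at `x` of the Levi-Civita covariant derivative `v ↦ ∇_v Y`: for `Y` differentiable
at `x`, `∇_v Y` is the tangent vector with `2 g(∇_v Y, z) = koszul X Y Z x` for all `z`, where
`X`, `Z` are any vector fields, differentiable at `x`, with `X x = v` and `Z x = z`. -/
def leviCivitaFun (Y : Π x : M, TangentSpace I x) (x : M) :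
    TangentSpace I x →L[ℝ] TangentSpace I x :=
  if hY : MDifferentiableAt I I.tangent (fun x => (⟨x, Y x⟩ : TangentBundle I M)) x then
    ∑ i, ((2 : ℝ)⁻¹ • (TensorialAt.mkHom₂ (fun X Z => koszul X Y Z x) x
      (fun _ hZ => koszul_tensorial₁ hY hZ) (fun _ hX => koszul_tensorial₂ hX hY)).flip
        (stdOrthonormalBasis ℝ (TangentSpace I x) i)).smulRight
          (stdOrthonormalBasis ℝ (TangentSpace I x) i)
  else 0

lemma inner_leviCivitaFun {X Y Z : Π x : M, TangentSpace I x} {x : M}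
    (hX : MDifferentiableAt I I.tangent (fun x => (⟨x, X x⟩ : TangentBundle I M)) x)
    (hY : MDifferentiableAt I I.tangent (fun x => (⟨x, Y x⟩ : TangentBundle I M)) x)
    (hZ : MDifferentiableAt I I.tangent (fun x => (⟨x, Z x⟩ : TangentBundle I M)) x) :
    inner ℝ (leviCivitaFun Y x (X x)) (Z x) = 2⁻¹ * koszul X Y Z x := by
  have key := TensorialAt.mkHom₂_apply (Φ := fun X Z => koszul X Y Z x)
    (fun _ hZ => koszul_tensorial₁ hY hZ) (fun _ hX => koszul_tensorial₂ hX hY) hX hZ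
  rw [leviCivitaFun, dif_pos hY, ← key]
  set B := TensorialAt.mkHom₂ (fun X Z => koszul X Y Z x) x
      (fun _ hZ => koszul_tensorial₁ hY hZ) (fun _ hX => koszul_tensorial₂ hX hY)
  set b := stdOrthonormalBasis ℝ (TangentSpace I x)
  have hz : B (X x) (Z x) = ∑ i, inner ℝ (b i) (Z x) * B (X x) (b i) := by
    conv_lhs => rw [← b.sum_repr' (Z x)]
    simp [map_sum]
  rw [hz, Finset.mul_sum, _root_.sum_apply, sum_inner]
  refine Finset.sum_congr rfl fun i _ => ?_
  simp [inner_smul_left]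
  ring

lemma ext_inner_leviCivita {x : M} {A B : TangentSpace I x →L[ℝ] TangentSpace I x}
    (h : ∀ X Z : Π x : M, TangentSpace I x,
      MDifferentiableAt I I.tangent (fun x => (⟨x, X x⟩ : TangentBundle I M)) x →
      MDifferentiableAt I I.tangent (fun x => (⟨x, Z x⟩ : TangentBundle I M)) x →
      inner ℝ (A (X x)) (Z x) = inner ℝ (B (X x)) (Z x)) : A = B := by
  ext1 v
  refine ext_inner_right ℝ fun z => ?_
  simpa using h _ _ (mdifferentiableAt_extend_tangent v) (mdifferentiableAt_extend_tangent z)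

variable (I M) in
/-- The Levi-Civita covariant derivative of a Riemannian manifold. -/
def leviCivita : CovariantDerivative I E (fun x : M => TangentSpace I x) where
  toFun := leviCivitaFun
  isCovariantDerivativeOnUniv :=
    { add := by
        intro Y Y' x hY hY' _
        have : CompleteSpace E := FiniteDimensional.complete ℝ E
        refine ext_inner_leviCivita fun X Z hX hZ => ?_
        have hs : MDifferentiableAt I I.tangent
            (fun x => (⟨x, (Y + Y') x⟩ : TangentBundle I M)) x :=
          mdifferentiableAt_add_section hY hY'
        rw [inner_leviCivitaFun hX hs hZ, _root_.add_apply, inner_add_left,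
          inner_leviCivitaFun hX hY hZ, inner_leviCivitaFun hX hY' hZ]
        have h1 : ⟪Y + Y', Z⟫ = fun x => ⟪Y, Z⟫ x + ⟪Y', Z⟫ x := by ext; simp [inner_add_left]
        have h2 : ⟪X, Y + Y'⟫ = fun x => ⟪X, Y⟫ x + ⟪X, Y'⟫ x := by ext; simp [inner_add_right]
        simp only [koszul]
        rw [h1, h2, mvfderiv_fun_add (mdifferentiableAt_inner hY hZ) (mdifferentiableAt_inner hY' hZ),
          mvfderiv_fun_add (mdifferentiableAt_inner hX hY) (mdifferentiableAt_inner hX hY'),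
          mlieBracket_add_left hY hY', mlieBracket_add_right hY hY']
        simp [inner_add_left, inner_add_right]
        ring
      leibniz := by
        intro Y f x hY hf _
        have : CompleteSpace E := FiniteDimensional.complete ℝ E
        refine ext_inner_leviCivita fun X Z hX hZ => ?_
        have hs : MDifferentiableAt I I.tangent
            (fun x => (⟨x, (f • Y) x⟩ : TangentBundle I M)) x :=
          MDifferentiableAt.smul_section hf hY
        rw [inner_leviCivitaFun hX hs hZ, _root_.add_apply, inner_add_left,
          _root_.smul_apply, inner_smul_left, inner_leviCivitaFun hX hY hZ,
          ContinuousLinearMap.smulRight_apply, inner_smul_left]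
        have h1 : ⟪f • Y, Z⟫ = fun x => f x * ⟪Y, Z⟫ x := by ext; simp [inner_smul_left]
        have h2 : ⟪X, f • Y⟫ = fun x => f x * ⟪X, Y⟫ x := by ext; simp [inner_smul_right]
        simp only [koszul]
        rw [h1, h2, mvfderiv_fun_mul hf (mdifferentiableAt_inner hY hZ),
          mvfderiv_fun_mul hf (mdifferentiableAt_inner hX hY),
          mlieBracket_smul_left hf hY, mlieBracket_smul_right hf hY]
        simp [inner_add_left, inner_smul_left, inner_smul_right, real_inner_comm]
        ring }

/-- `∇` is compatible with the metric: `X g(Y, Z) = g(∇_X Y, Z) + g(Y, ∇_X Z)`. -/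
lemma leviCivita_metric {X Y Z : Π x : M, TangentSpace I x} {x : M}
    (hX : MDifferentiableAt I I.tangent (fun x => (⟨x, X x⟩ : TangentBundle I M)) x)
    (hY : MDifferentiableAt I I.tangent (fun x => (⟨x, Y x⟩ : TangentBundle I M)) x)
    (hZ : MDifferentiableAt I I.tangent (fun x => (⟨x, Z x⟩ : TangentBundle I M)) x) :
    mvfderiv I ⟪Y, Z⟫ x (X x)
      = inner ℝ (leviCivita I M Y x (X x)) (Z x) + inner ℝ (Y x) (leviCivita I M Z x (X x)) := by
  have h1 := inner_leviCivitaFun hX hY hZ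
  have h2 := inner_leviCivitaFun hX hZ hY
  change _ = inner ℝ (leviCivitaFun Y x (X x)) (Z x) + inner ℝ (Y x) (leviCivitaFun Z x (X x))
  rw [real_inner_comm (leviCivitaFun Z x (X x)), h1, h2]
  have h3 : ⟪Z, Y⟫ = ⟪Y, Z⟫ := by ext; exact real_inner_comm _ _
  simp only [koszul]
  rw [h3, mlieBracket_swap_apply (V := Z) (W := Y)]
  simp
  ring

/-- `∇` is torsion free: `∇_X Y - ∇_Y X = [X, Y]`. -/
lemma leviCivita_torsion_eq_zero [CompleteSpace E] : (leviCivita I M).torsion = 0 := by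
  rw [CovariantDerivative.torsion_eq_zero_iff]
  intro X Y x hX hY
  refine ext_inner_right ℝ fun z => ?_
  have hZ := mdifferentiableAt_extend_tangent z
  have h1 := inner_leviCivitaFun hX hY hZ
  have h2 := inner_leviCivitaFun hY hX hZ
  rw [FiberBundle.extend_apply_self] at h1 h2
  change inner ℝ (leviCivitaFun Y x (X x) - leviCivitaFun X x (Y x)) z = _
  have h3 : ⟪Y, X⟫ = ⟪X, Y⟫ := by ext; exact real_inner_comm _ _
  rw [inner_sub_left, h1, h2]
  simp only [koszul]
  rw [h3, mlieBracket_swap_apply (V := Y) (W := X)]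
  simp
  ring

/-! ### Semi-norms of a dynamical system -/

/-- `|X|_M = sup_m |X(m)|_g`. -/
def fieldNorm (X : Cₛ^∞⟮I; E, fun x : M => TangentSpace I x⟯) : ENNReal :=
  ⨆ m : M, ‖X m‖ₑ

/-- `|∇X|_M = sup_m sup_{v ∈ T_m M, |v| = 1} |∇_v X|_g`. -/
def covNorm (X : Cₛ^∞⟮I; E, fun x : M => TangentSpace I x⟯) : ENNReal :=
  ⨆ (m : M) (v : TangentSpace I m) (_ : ‖v‖ = 1), ‖leviCivita I M X m v‖ₑ

variable {d : ℕ}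

/-- `|V^{(κ)}|_M = sup {|V_A|_M : A ∈ F^{(κ)}(ℝᵈ), |A| = 1}`. -/
def systemNorm (κ : ℕ)
    (V : EuclideanSpace ℝ (Fin d) →ₗ[ℝ] Cₛ^∞⟮I; E, fun x : M => TangentSpace I x⟯) : ENNReal :=
  ⨆ (A : freeNilpotentLie (EuclideanSpace ℝ (Fin d)) κ)
    (_ : tensorNorm (A : TensorAlgebra ℝ (EuclideanSpace ℝ (Fin d))) = 1),
    fieldNorm (nilpotentExtension κ V A)

/-- `|∇V^{(κ)}|_M = sup {|∇V_A|_M : A ∈ F^{(κ)}(ℝᵈ), |A| = 1}`. -/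
def systemCovNorm (κ : ℕ)
    (V : EuclideanSpace ℝ (Fin d) →ₗ[ℝ] Cₛ^∞⟮I; E, fun x : M => TangentSpace I x⟯) : ENNReal :=
  ⨆ (A : freeNilpotentLie (EuclideanSpace ℝ (Fin d)) κ)
    (_ : tensorNorm (A : TensorAlgebra ℝ (EuclideanSpace ℝ (Fin d))) = 1),
    covNorm (nilpotentExtension κ V A)

end Manifold

section Statement

variable {E : Type*} [NormedAddCommGroup E] [NormedSpace ℝ E]
  {H : Type*} [TopologicalSpace H] {I : ModelWithCorners ℝ E H}

/-- The hypotheses of the global existence theorem for the rough differential equation driven by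
the dynamical system `V`: the Riemannian metric is complete and
`|V^{(κ)}|_M + |∇V^{(κ)}|_M < ∞`. -/
def GlobalExistenceHypotheses [FiniteDimensional ℝ E]
    {M : Type*} [EMetricSpace M] [ChartedSpace H M] [IsManifold I ∞ M]
    [Bundle.RiemannianBundle (fun x : M => TangentSpace I x)]
    [IsContMDiffRiemannianBundle I ∞ E (fun x : M => TangentSpace I x)]
    [IsRiemannianManifold I M] {d : ℕ} (κ : ℕ)
    (V : EuclideanSpace ℝ (Fin d) →ₗ[ℝ] Cₛ^∞⟮I; E, fun x : M => TangentSpace I x⟯) : Prop :=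
  CompleteSpace M ∧ systemNorm κ V + systemCovNorm κ V < ⊤

/-- The iterated derivative `V_{a₁} V_{a₂} ⋯ V_{aₖ} f` of a vector-valued function `f` along the
vector fields `V_a`, for the list `l = [a₁, …, aₖ]` (it is `f` if `l` is empty). -/
def iteratedFieldDeriv {M : Type*} [TopologicalSpace M] [ChartedSpace H M] {W F : Type*}
    [NormedAddCommGroup F] [NormedSpace ℝ F]
    (V : W → Π x : M, TangentSpace I x) (l : List W) (f : M → F) : M → F :=
  l.foldr (fun a h m => mvfderiv I h m (V a m)) f

end Statement

end RoughFlow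

end

noncomputable section

namespace RoughFlow

/-! ### Functions with bounded iterated derivatives along vector fields -/

section BoundedDerivatives

variable {E : Type*} [NormedAddCommGroup E] [NormedSpace ℝ E]
  {H : Type*} [TopologicalSpace H] {I : ModelWithCorners ℝ E H}
  {M : Type*} [TopologicalSpace M] [ChartedSpace H M]
  {F : Type*} [NormedAddCommGroup F] [NormedSpace ℝ F]
  {G : Type*} [NormedAddCommGroup G] [NormedSpace ℝ G]

lemma mvfderiv_clm_comp (T : F →L[ℝ] G) {f : M → F} {m : M} (hf : MDifferentiableAt I 𝓘(ℝ, F) f m) :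
    mvfderiv I (fun x => T (f x)) m = T ∘L mvfderiv I f m := by
  have h : mfderiv I 𝓘(ℝ, G) (T ∘ f) m = (mfderiv 𝓘(ℝ, F) 𝓘(ℝ, G) T (f m)).comp
      (mfderiv I 𝓘(ℝ, F) f m) := mfderiv_comp m T.mdifferentiableAt hf
  rw [T.mfderiv_eq] at h
  ext v
  exact congrArg (fun S => S v) h

variable [IsManifold I ∞ M] {W : Type*} {V : W → Cₛ^∞⟮I; E, fun x : M => TangentSpace I x⟯}

lemma contMDiff_mvfderiv_apply {f : M → F} (hf : ContMDiff I 𝓘(ℝ, F) ∞ f)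
    (X : Cₛ^∞⟮I; E, fun x : M => TangentSpace I x⟯) :
    ContMDiff I 𝓘(ℝ, F) ∞ fun m => mvfderiv I f m (X m) :=
  (contMDiff_snd_tangentBundle_modelSpace F 𝓘(ℝ, F)).comp
    ((hf.contMDiff_tangentMap (m := ∞) (by simp)).comp X.contMDiff)

lemma contMDiff_iteratedFieldDeriv {f : M → F} (hf : ContMDiff I 𝓘(ℝ, F) ∞ f) (l : List W) :
    ContMDiff I 𝓘(ℝ, F) ∞ (iteratedFieldDeriv (I := I) (fun a x => V a x) l f) := by
  induction l with
  | nil => exact hf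
  | cons a l ih => exact contMDiff_mvfderiv_apply ih (V a)

lemma iteratedFieldDeriv_clm_comp (T : F →L[ℝ] G) {f : M → F} (hf : ContMDiff I 𝓘(ℝ, F) ∞ f)
    (l : List W) :
    iteratedFieldDeriv (I := I) (fun a x => V a x) l (fun x => T (f x))
      = fun x => T (iteratedFieldDeriv (I := I) (fun a x => V a x) l f x) := by
  induction l with
  | nil => rfl
  | cons a l ih =>
    funext m
    have h := mvfderiv_clm_comp T ((contMDiff_iteratedFieldDeriv (V := V) hf l).mdifferentiable
      (by simp) m)
    change mvfderiv I (iteratedFieldDeriv _ l _) m (V a m) = _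
    rw [ih, h]
    rfl

variable (V) in
/-- Smooth real functions `f` such that `V_{a₁} ⋯ V_{aₖ} f` is bounded for all `k ≤ n`. -/
def BoundedFieldDeriv : ℕ → (M → ℝ) → Prop
  | 0, f => ContMDiff I 𝓘(ℝ, ℝ) ∞ f ∧ ∃ C : ℝ, ∀ m, |f m| ≤ C
  | n + 1, f => (ContMDiff I 𝓘(ℝ, ℝ) ∞ f ∧ ∃ C : ℝ, ∀ m, |f m| ≤ C) ∧
      ∀ a, BoundedFieldDeriv n fun m => mvfderiv I f m (V a m)

namespace BoundedFieldDeriv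

lemma zero_of {n : ℕ} {f : M → ℝ} (h : BoundedFieldDeriv V n f) : BoundedFieldDeriv V 0 f := by
  cases n with
  | zero => exact h
  | succ n => exact h.1

lemma contMDiff {n : ℕ} {f : M → ℝ} (h : BoundedFieldDeriv V n f) : ContMDiff I 𝓘(ℝ, ℝ) ∞ f :=
  h.zero_of.1

lemma mdifferentiableAt {n : ℕ} {f : M → ℝ} (h : BoundedFieldDeriv V n f) (m : M) :
    MDifferentiableAt I 𝓘(ℝ, ℝ) f m :=
  h.contMDiff.mdifferentiable (by simp) m

lemma exists_bound {n : ℕ} {f : M → ℝ} (h : BoundedFieldDeriv V n f) :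
    ∃ C : ℝ, ∀ m, |f m| ≤ C :=
  h.zero_of.2

lemma of_succ {n : ℕ} : ∀ {f : M → ℝ}, BoundedFieldDeriv V (n + 1) f → BoundedFieldDeriv V n f := by
  induction n with
  | zero => exact fun h => h.1
  | succ n ih => exact fun h => ⟨h.1, fun a => ih (h.2 a)⟩

lemma mono {n k : ℕ} {f : M → ℝ} (h : BoundedFieldDeriv V n f) (hk : k ≤ n) :
    BoundedFieldDeriv V k f := by
  induction hk using Nat.decreasingInduction with
  | self => exact h
  | of_succ j _ ih => exact ih.of_succ

lemma of_iteratedFieldDeriv {n : ℕ} : ∀ {f : M → ℝ}, ContMDiff I 𝓘(ℝ, ℝ) ∞ f →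
    (∀ l : List W, l.length ≤ n →
      ∃ C : ℝ, ∀ m, |iteratedFieldDeriv (I := I) (fun a x => V a x) l f m| ≤ C) →
    BoundedFieldDeriv V n f := by
  induction n with
  | zero => exact fun hf h => ⟨hf, h [] le_rfl⟩
  | succ n ih =>
    refine fun hf h => ⟨⟨hf, h [] (Nat.zero_le _)⟩, fun a =>
      ih (contMDiff_mvfderiv_apply hf (V a)) fun l hl => ?_⟩
    simpa [iteratedFieldDeriv] using h (l ++ [a]) (by simpa using hl)

lemma const (n : ℕ) : ∀ c : ℝ, BoundedFieldDeriv V n fun _ => c := by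
  induction n with
  | zero => exact fun c => ⟨contMDiff_const, |c|, fun _ => le_rfl⟩
  | succ n ih =>
    refine fun c => ⟨⟨contMDiff_const, |c|, fun _ => le_rfl⟩, fun a => ?_⟩
    simpa [mvfderiv_const] using ih 0

lemma add {n : ℕ} : ∀ {f g : M → ℝ}, BoundedFieldDeriv V n f → BoundedFieldDeriv V n g →
    BoundedFieldDeriv V n fun m => f m + g m := by
  have h0 : ∀ {f g : M → ℝ}, BoundedFieldDeriv V 0 f → BoundedFieldDeriv V 0 g →
      BoundedFieldDeriv V 0 fun m => f m + g m := by
    rintro f g ⟨hf, C, hC⟩ ⟨hg, D, hD⟩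
    exact ⟨hf.add hg, C + D, fun m => (abs_add_le _ _).trans (add_le_add (hC m) (hD m))⟩
  induction n with
  | zero => exact h0
  | succ n ih =>
    refine fun {f g} hf hg => ⟨h0 hf.zero_of hg.zero_of, fun a => ?_⟩
    convert ih (hf.2 a) (hg.2 a) using 2 with m
    rw [mvfderiv_fun_add (hf.mdifferentiableAt m) (hg.mdifferentiableAt m)]
    rfl

lemma mul {n : ℕ} : ∀ {f g : M → ℝ}, BoundedFieldDeriv V n f → BoundedFieldDeriv V n g →
    BoundedFieldDeriv V n fun m => f m * g m := by
  have h0 : ∀ {f g : M → ℝ}, BoundedFieldDeriv V 0 f → BoundedFieldDeriv V 0 g →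
      BoundedFieldDeriv V 0 fun m => f m * g m := by
    rintro f g ⟨hf, C, hC⟩ ⟨hg, D, hD⟩
    refine ⟨hf.mul hg, C * D, fun m => ?_⟩
    rw [abs_mul]
    exact mul_le_mul (hC m) (hD m) (abs_nonneg _) ((abs_nonneg _).trans (hC m))
  induction n with
  | zero => exact h0
  | succ n ih =>
    refine fun {f g} hf hg => ⟨h0 hf.zero_of hg.zero_of, fun a => ?_⟩
    convert (ih hf.of_succ (hg.2 a)).add (ih hg.of_succ (hf.2 a)) using 2 with m
    rw [mvfderiv_fun_mul (hf.mdifferentiableAt m) (hg.mdifferentiableAt m)]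
    rfl

lemma sum {ι : Type*} {n : ℕ} (s : Finset ι) {f : ι → M → ℝ}
    (h : ∀ i ∈ s, BoundedFieldDeriv V n (f i)) :
    BoundedFieldDeriv V n fun m => ∑ i ∈ s, f i m := by
  classical
  induction s using Finset.induction_on with
  | empty => simpa using const n 0
  | insert i s hi ih =>
    simp only [Finset.sum_insert hi]
    exact (h i (by simp)).add (ih fun j hj => h j (by simp [hj]))

end BoundedFieldDeriv

end BoundedDerivatives

/-! ### Suprema over the unit sphere of the free nilpotent Lie algebra -/

section UnitSphere

instance {W : Type*} [AddCommGroup W] [Module ℝ W] [FiniteDimensional ℝ W] (κ : ℕ) :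
    FiniteDimensional ℝ (freeNilpotentLie W κ) := by
  have hk : ∀ k, FiniteDimensional ℝ (tensorDegree W k) := fun k =>
    Module.Finite.iff_fg.2 ((Module.Finite.iff_fg.1 inferInstance).pow k)
  have hle : freeNilpotentLie W κ ≤ ⨆ k : Fin (κ + 1), tensorDegree W k := by
    refine (freeNilpotentLie_le_span κ).trans (Submodule.span_le.2 ?_)
    rintro _ ⟨l, u, hl, rfl⟩
    exact Submodule.mem_iSup_of_mem (p := fun k : Fin (κ + 1) => tensorDegree W k)
      ⟨l.length + 1, by omega⟩ (nestedBracket_mem_tensorDegree l u)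
  exact Submodule.finiteDimensional_of_le hle

/-- The extension of `f` to `F^{(κ)}(W)` takes values in the span of the nested brackets of `f`. -/
lemma nilpotentExtension_mem_span {W : Type*} [AddCommGroup W] [Module ℝ W] {L : Type*}
    [LieRing L] [LieAlgebra ℝ L] (κ : ℕ) (f : W →ₗ[ℝ] L) (A : freeNilpotentLie W κ) :
    nilpotentExtension κ f A ∈ Submodule.span ℝ
      {x | ∃ (l : List W) (u : W), l.length + 1 ≤ κ ∧ x = nestedBracket f l u} := by
  have hle : freeNilpotentLie W κ ≤ (Submodule.comap (nilpotentExtension κ f) (Submodule.span ℝ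
      {x | ∃ (l : List W) (u : W), l.length + 1 ≤ κ ∧ x = nestedBracket f l u})).map
      (freeNilpotentLie W κ).subtype := by
    refine (freeNilpotentLie_le_span κ).trans (Submodule.span_le.2 ?_)
    rintro _ ⟨l, u, hl, rfl⟩
    refine ⟨⟨_, nestedBracket_mem l u hl⟩, Submodule.mem_comap.2 ?_, rfl⟩
    rw [nilpotentExtension_nestedBracket κ f l u hl]
    exact Submodule.subset_span ⟨l, u, hl, rfl⟩
  obtain ⟨B, hB, hBA⟩ := hle A.2
  rwa [← Subtype.ext hBA]

/-- A subadditive absolutely homogeneous functional that is finite on the range of a linear map on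
`F^{(κ)}(ℝᵈ)` is bounded on the image of the unit sphere. -/
lemma iSup_tensorNorm_eq_one_lt_top {d κ : ℕ} {L : Type*} [AddCommGroup L] [Module ℝ L]
    (Φ : freeNilpotentLie (EuclideanSpace ℝ (Fin d)) κ →ₗ[ℝ] L) (p : L → ENNReal)
    (p_zero : p 0 = 0) (p_add : ∀ X Y, p (X + Y) ≤ p X + p Y)
    (p_smul : ∀ (c : ℝ) X, p (c • X) ≤ ‖c‖ₑ * p X) (hp : ∀ A, p (Φ A) < ⊤) :
    ⨆ (A : freeNilpotentLie (EuclideanSpace ℝ (Fin d)) κ)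
      (_ : tensorNorm (A : TensorAlgebra ℝ (EuclideanSpace ℝ (Fin d))) = 1), p (Φ A) < ⊤ := by
  classical
  let b := (EuclideanSpace.basisFun (Fin d) ℝ).toBasis.tensorAlgebra
  let β := Module.finBasis ℝ (freeNilpotentLie (EuclideanSpace ℝ (Fin d)) κ)
  let S : Finset (FreeMonoid (Fin d)) := Finset.univ.biUnion fun i =>
    (b.repr (β i : TensorAlgebra ℝ (EuclideanSpace ℝ (Fin d)))).support
  have hS : ∀ A : freeNilpotentLie (EuclideanSpace ℝ (Fin d)) κ,
      b.repr (A : TensorAlgebra ℝ (EuclideanSpace ℝ (Fin d))) ∈ Finsupp.supported ℝ ℝ (S : Set _) := by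
    intro A
    rw [← β.sum_repr A]
    simp only [Submodule.coe_sum, Submodule.coe_smul, map_sum, map_smul]
    refine Submodule.sum_mem _ fun i _ => Submodule.smul_mem _ _ ?_
    rw [Finsupp.mem_supported]
    exact_mod_cast Finset.subset_biUnion_of_mem
      (fun i => (b.repr (β i : TensorAlgebra ℝ (EuclideanSpace ℝ (Fin d)))).support)
      (Finset.mem_univ i)
  let T : freeNilpotentLie (EuclideanSpace ℝ (Fin d)) κ →ₗ[ℝ] (S → ℝ) :=
    LinearMap.pi fun s => Finsupp.lapply (s : FreeMonoid (Fin d)) ∘ₗ b.repr.toLinearMap ∘ₗ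
      (freeNilpotentLie (EuclideanSpace ℝ (Fin d)) κ).subtype
  have hT : LinearMap.ker T = ⊥ := by
    refine LinearMap.ker_eq_bot'.2 fun A hA => ?_
    have h0 : b.repr (A : TensorAlgebra ℝ (EuclideanSpace ℝ (Fin d))) = 0 := by
      ext w
      by_cases hw : w ∈ S
      · exact congrFun hA ⟨w, hw⟩
      · have := (Finsupp.mem_supported _ _).1 (hS A)
        exact Finsupp.notMem_support_iff.1 fun h => hw (this h)
    exact Subtype.ext (b.repr.map_eq_zero_iff.1 h0)
  obtain ⟨g, hg⟩ := T.exists_leftInverse_of_injective hT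
  refine lt_of_le_of_lt (b := ∑ s : S, p (Φ (g (Pi.single s 1)))) (iSup₂_le fun A hA => ?_)
    (ENNReal.sum_lt_top.2 fun s _ => hp _)
  have hcoord : ∀ s : S, |T A s| ≤ 1 := by
    intro s
    have h1 : ((b.repr (A : TensorAlgebra ℝ (EuclideanSpace ℝ (Fin d)))).sum fun _ c => c ^ 2) = 1 :=
      Real.sqrt_eq_one.1 hA
    have h2 : (b.repr (A : TensorAlgebra ℝ (EuclideanSpace ℝ (Fin d)))) s ^ 2 ≤ 1 := by
      rw [← h1]
      by_cases hs : (s : FreeMonoid (Fin d)) ∈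
          (b.repr (A : TensorAlgebra ℝ (EuclideanSpace ℝ (Fin d)))).support
      · exact Finset.single_le_sum (f := fun w =>
          (b.repr (A : TensorAlgebra ℝ (EuclideanSpace ℝ (Fin d)))) w ^ 2)
          (fun _ _ => sq_nonneg _) hs
      · rw [Finsupp.notMem_support_iff.1 hs]
        simpa only [ne_eq, OfNat.ofNat_ne_zero, not_false_eq_true, zero_pow] using!
          Finset.sum_nonneg fun _ _ => sq_nonneg _
    exact sq_le_one_iff_abs_le_one _ |>.1 h2
  have hsum : ∀ (s : Finset S) (X : S → L), p (∑ i ∈ s, X i) ≤ ∑ i ∈ s, p (X i) :=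
    fun s X => Finset.le_sum_of_subadditive p p_zero.le p_add s X
  have hA' : Φ A = ∑ s : S, T A s • Φ (g (Pi.single s 1)) := by
    have h1 : A = g (T A) := (LinearMap.congr_fun hg A).symm
    conv_lhs => rw [h1, pi_eq_sum_univ' (T A)]
    simp only [map_sum, map_smul]
  rw [hA']
  refine (hsum _ _).trans (Finset.sum_le_sum fun s _ => (p_smul _ _).trans ?_)
  calc _ ≤ 1 * p (Φ (g (Pi.single s 1))) := by
        gcongr
        rw [Real.enorm_eq_ofReal_abs, ← ENNReal.ofReal_one]
        exact ENNReal.ofReal_le_ofReal (hcoord s)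
    _ = _ := one_mul _

/-- A subadditive absolutely homogeneous functional that is finite on the right-nested brackets of
`f` of length at most `κ` is bounded on the image of the unit sphere under the extension of `f`. -/
lemma iSup_nilpotentExtension_lt_top {d κ : ℕ} {L : Type*} [LieRing L] [LieAlgebra ℝ L]
    (f : EuclideanSpace ℝ (Fin d) →ₗ[ℝ] L) (p : L → ENNReal)
    (p_zero : p 0 = 0) (p_add : ∀ X Y, p (X + Y) ≤ p X + p Y)
    (p_smul : ∀ (c : ℝ) X, p (c • X) ≤ ‖c‖ₑ * p X)
    (hp : ∀ (l : List (EuclideanSpace ℝ (Fin d))) (u : EuclideanSpace ℝ (Fin d)),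
      l.length + 1 ≤ κ → p (nestedBracket f l u) < ⊤) :
    ⨆ (A : freeNilpotentLie (EuclideanSpace ℝ (Fin d)) κ)
      (_ : tensorNorm (A : TensorAlgebra ℝ (EuclideanSpace ℝ (Fin d))) = 1),
        p (nilpotentExtension κ f A) < ⊤ := by
  refine iSup_tensorNorm_eq_one_lt_top _ p p_zero p_add p_smul fun A => ?_
  have hA := nilpotentExtension_mem_span κ f A
  generalize nilpotentExtension κ f A = X at hA ⊢
  induction hA using Submodule.span_induction with
  | zero => simp [p_zero]
  | add x y _ _ hx hy => exact (p_add x y).trans_lt (ENNReal.add_lt_top.2 ⟨hx, hy⟩)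
  | smul c x _ hx => exact (p_smul c x).trans_lt (ENNReal.mul_lt_top enorm_lt_top hx)
  | mem x hx =>
    obtain ⟨l, u, hl, rfl⟩ := hx
    exact hp l u hl

end UnitSphere

/-! ### The semi-norms of vector fields -/

section SemiNorms

variable {E : Type*} [NormedAddCommGroup E] [NormedSpace ℝ E]
  {H : Type*} [TopologicalSpace H] {I : ModelWithCorners ℝ E H}
  {M : Type*} [TopologicalSpace M] [ChartedSpace H M] [IsManifold I ∞ M]
  [Bundle.RiemannianBundle (fun x : M => TangentSpace I x)]

lemma fieldNorm_zero : fieldNorm (0 : Cₛ^∞⟮I; E, fun x : M => TangentSpace I x⟯) = 0 := by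
  simp [fieldNorm]

lemma fieldNorm_add_le (X Y : Cₛ^∞⟮I; E, fun x : M => TangentSpace I x⟯) :
    fieldNorm (X + Y) ≤ fieldNorm X + fieldNorm Y :=
  iSup_le fun m => (enorm_add_le _ _).trans
    (add_le_add (le_iSup (fun m => ‖X m‖ₑ) m) (le_iSup (fun m => ‖Y m‖ₑ) m))

lemma fieldNorm_smul_le (c : ℝ) (X : Cₛ^∞⟮I; E, fun x : M => TangentSpace I x⟯) :
    fieldNorm (c • X) ≤ ‖c‖ₑ * fieldNorm X :=
  iSup_le fun m => (enorm_smul c (X m)).le.trans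
    (mul_le_mul_right (le_iSup (fun m => ‖X m‖ₑ) m) _)

variable [FiniteDimensional ℝ E]
  [IsContMDiffRiemannianBundle I ∞ E (fun x : M => TangentSpace I x)]

lemma enorm_leviCivita_le_covNorm (X : Cₛ^∞⟮I; E, fun x : M => TangentSpace I x⟯) (m : M)
    (v : TangentSpace I m) (hv : ‖v‖ = 1) : ‖leviCivita I M X m v‖ₑ ≤ covNorm X :=
  le_iSup_of_le m (le_iSup₂_of_le v hv le_rfl)

lemma leviCivita_add_apply (X Y : Cₛ^∞⟮I; E, fun x : M => TangentSpace I x⟯) (m : M)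
    (v : TangentSpace I m) :
    leviCivita I M (X + Y : Cₛ^∞⟮I; E, fun x : M => TangentSpace I x⟯) m v
      = leviCivita I M X m v + leviCivita I M Y m v :=
  congrArg (fun T => T v) ((leviCivita I M).isCovariantDerivativeOnUniv.add
    X.mdifferentiableAt Y.mdifferentiableAt trivial)

lemma leviCivita_smul_apply (c : ℝ) (X : Cₛ^∞⟮I; E, fun x : M => TangentSpace I x⟯) (m : M)
    (v : TangentSpace I m) :
    leviCivita I M (c • X : Cₛ^∞⟮I; E, fun x : M => TangentSpace I x⟯) m v
      = c • leviCivita I M X m v := by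
  have h := (leviCivita I M).isCovariantDerivativeOnUniv.leibniz (g := fun _ => c)
    X.mdifferentiableAt (mdifferentiableAt_const (x := m)) trivial
  simpa [mvfderiv_const] using! congrArg (fun T => T v) h

lemma covNorm_add_le (X Y : Cₛ^∞⟮I; E, fun x : M => TangentSpace I x⟯) :
    covNorm (X + Y) ≤ covNorm X + covNorm Y := by
  refine iSup_le fun m => iSup₂_le fun v hv => ?_
  rw [leviCivita_add_apply]
  exact (enorm_add_le _ _).trans (add_le_add (enorm_leviCivita_le_covNorm X m v hv)
    (enorm_leviCivita_le_covNorm Y m v hv))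

lemma covNorm_smul_le (c : ℝ) (X : Cₛ^∞⟮I; E, fun x : M => TangentSpace I x⟯) :
    covNorm (c • X) ≤ ‖c‖ₑ * covNorm X := by
  refine iSup_le fun m => iSup₂_le fun v hv => ?_
  rw [leviCivita_smul_apply, enorm_smul]
  exact mul_le_mul_right (enorm_leviCivita_le_covNorm X m v hv) _

lemma covNorm_zero : covNorm (0 : Cₛ^∞⟮I; E, fun x : M => TangentSpace I x⟯) = 0 := by
  simpa using covNorm_smul_le 0 (0 : Cₛ^∞⟮I; E, fun x : M => TangentSpace I x⟯)

lemma leviCivita_sub_eq_bracket (X Y : Cₛ^∞⟮I; E, fun x : M => TangentSpace I x⟯) (m : M) :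
    leviCivita I M Y m (X m) - leviCivita I M X m (Y m) = ⁅X, Y⁆ m := by
  have : CompleteSpace E := FiniteDimensional.complete ℝ E
  exact (CovariantDerivative.torsion_eq_zero_iff _).1 leviCivita_torsion_eq_zero
    X.mdifferentiableAt Y.mdifferentiableAt

end SemiNorms

/-! ### Global orthonormal frames -/

section Frame

variable {d : ℕ} {M : Type*} [TopologicalSpace M] [ChartedSpace (EuclideanSpace ℝ (Fin d)) M]
  [IsManifold (𝓡 d) ∞ M]
  [Bundle.RiemannianBundle (fun x : M => TangentSpace (𝓡 d) x)]
  {V : EuclideanSpace ℝ (Fin d) →ₗ[ℝ]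
      Cₛ^∞⟮𝓡 d; EuclideanSpace ℝ (Fin d), fun x : M => TangentSpace (𝓡 d) x⟯}

variable (V) in
/-- The `i`-th vector field `V_{eᵢ}` of the frame `V`. -/
def frame (i : Fin d) : Cₛ^∞⟮𝓡 d; EuclideanSpace ℝ (Fin d), fun x : M => TangentSpace (𝓡 d) x⟯ :=
  V (EuclideanSpace.basisFun (Fin d) ℝ i)

variable (V) in
/-- The `k`-th component `g(X, V_{eₖ})` of a vector field in the frame `V`. -/
def frameCoord (X : Cₛ^∞⟮𝓡 d; EuclideanSpace ℝ (Fin d), fun x : M => TangentSpace (𝓡 d) x⟯)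
    (k : Fin d) (m : M) : ℝ :=
  inner ℝ (X m) (frame V k m)

variable (hV : ∀ (a b : EuclideanSpace ℝ (Fin d)) (m : M), inner ℝ (V a m) (V b m) = inner ℝ a b)

include hV

lemma exists_orthonormalBasis_frame (m : M) :
    ∃ b : OrthonormalBasis (Fin d) ℝ (TangentSpace (𝓡 d) m), ∀ i, b i = frame V i m := by
  have hon : Orthonormal ℝ fun i => frame V i m := by
    rw [orthonormal_iff_ite]
    intro i j
    rw [frame, frame, hV]
    exact orthonormal_iff_ite.1 (EuclideanSpace.basisFun (Fin d) ℝ).orthonormal i j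
  have hcard : Fintype.card (Fin d) = Module.finrank ℝ (TangentSpace (𝓡 d) m) := by
    change _ = Module.finrank ℝ (EuclideanSpace ℝ (Fin d))
    simp
  refine ⟨OrthonormalBasis.mk hon ?_, fun i => by rw [OrthonormalBasis.coe_mk]⟩
  exact (hon.linearIndependent.span_eq_top_of_card_eq_finrank' hcard).ge

lemma sum_inner_frame_smul {m : M} (v : TangentSpace (𝓡 d) m) :
    ∑ i, inner ℝ v (frame V i m) • frame V i m = v := by
  obtain ⟨b, hb⟩ := exists_orthonormalBasis_frame hV m
  conv_rhs => rw [← b.sum_repr' v]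
  simp [hb, real_inner_comm]

lemma abs_inner_frame_le {m : M} (v : TangentSpace (𝓡 d) m) (i : Fin d) :
    |inner ℝ v (frame V i m)| ≤ ‖v‖ := by
  obtain ⟨b, hb⟩ := exists_orthonormalBasis_frame hV m
  have h := abs_real_inner_le_norm v (frame V i m)
  rwa [← hb, b.norm_eq_one, mul_one, hb] at h

lemma norm_le_sum_abs_inner_frame {m : M} (v : TangentSpace (𝓡 d) m) :
    ‖v‖ ≤ ∑ i, |inner ℝ v (frame V i m)| := by
  obtain ⟨b, hb⟩ := exists_orthonormalBasis_frame hV m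
  conv_lhs => rw [← sum_inner_frame_smul hV v]
  refine (norm_sum_le _ _).trans (Finset.sum_le_sum fun i _ => ?_)
  rw [norm_smul, ← hb, b.norm_eq_one, mul_one, Real.norm_eq_abs]

lemma fieldNorm_lt_top {X : Cₛ^∞⟮𝓡 d; EuclideanSpace ℝ (Fin d), fun x : M => TangentSpace (𝓡 d) x⟯}
    (hX : ∀ k, ∃ C : ℝ, ∀ m, |frameCoord V X k m| ≤ C) : fieldNorm X < ⊤ := by
  choose C hC using hX
  refine lt_of_le_of_lt (iSup_le fun m => ?_) (ENNReal.ofReal_lt_top (r := ∑ k, C k))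
  rw [← ofReal_norm]
  exact ENNReal.ofReal_le_ofReal ((norm_le_sum_abs_inner_frame hV _).trans
    (Finset.sum_le_sum fun k _ => hC k m))

lemma frameCoord_apply (a : EuclideanSpace ℝ (Fin d)) (k : Fin d) :
    frameCoord V (V a) k = fun _ => inner ℝ a (EuclideanSpace.basisFun (Fin d) ℝ k) := by
  funext m
  exact hV _ _ m

variable [IsContMDiffRiemannianBundle (𝓡 d) ∞ (EuclideanSpace ℝ (Fin d))
  (fun x : M => TangentSpace (𝓡 d) x)]

omit hV

lemma contMDiff_frameCoord
    (X : Cₛ^∞⟮𝓡 d; EuclideanSpace ℝ (Fin d), fun x : M => TangentSpace (𝓡 d) x⟯) (k : Fin d) :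
    ContMDiff (𝓡 d) 𝓘(ℝ, ℝ) ∞ (frameCoord V X k) :=
  ContMDiff.inner_bundle (IB := 𝓡 d) (F := EuclideanSpace ℝ (Fin d))
    (E := fun x : M => TangentSpace (𝓡 d) x) (b := fun m : M => m) X.contMDiff
    (frame V k).contMDiff

lemma mvfderiv_frameCoord
    (X : Cₛ^∞⟮𝓡 d; EuclideanSpace ℝ (Fin d), fun x : M => TangentSpace (𝓡 d) x⟯) (k : Fin d)
    (m : M) (v : TangentSpace (𝓡 d) m) :
    mvfderiv (𝓡 d) (frameCoord V X k) m v
      = inner ℝ (leviCivita (𝓡 d) M X m v) (frame V k m)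
        + inner ℝ (X m) (leviCivita (𝓡 d) M (frame V k) m v) := by
  have h := leviCivita_metric (mdifferentiableAt_extend_tangent v)
    (X.mdifferentiableAt (x := m)) ((frame V k).mdifferentiableAt (x := m))
  rwa [FiberBundle.extend_apply_self] at h

include hV

lemma inner_leviCivita_frame_swap (i k : Fin d) (m : M) (v : TangentSpace (𝓡 d) m) :
    inner ℝ (frame V i m) (leviCivita (𝓡 d) M (frame V k) m v)
      = -inner ℝ (leviCivita (𝓡 d) M (frame V i) m v) (frame V k m) := by
  have h := mvfderiv_frameCoord (V := V) (frame V i) k m v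
  rw [frame, frameCoord_apply hV, mvfderiv_const] at h
  exact eq_neg_of_add_eq_zero_right h.symm

/-- The Leibniz rule for `[V_a, X]` in the components of `X` with respect to the frame. -/
lemma frameCoord_bracket (a : EuclideanSpace ℝ (Fin d))
    (X : Cₛ^∞⟮𝓡 d; EuclideanSpace ℝ (Fin d), fun x : M => TangentSpace (𝓡 d) x⟯) (k : Fin d)
    (m : M) :
    frameCoord V ⁅V a, X⁆ k m = mvfderiv (𝓡 d) (frameCoord V X k) m (V a m)
      + ∑ i, frameCoord V X i m * frameCoord V ⁅V a, frame V i⁆ k m := by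
  have hX := sum_inner_frame_smul hV (X m)
  have h1 : inner ℝ (X m) (leviCivita (𝓡 d) M (frame V k) m (V a m))
      = -∑ i, frameCoord V X i m *
        inner ℝ (leviCivita (𝓡 d) M (frame V i) m (V a m)) (frame V k m) := by
    conv_lhs => rw [← hX]
    simp only [sum_inner, inner_smul_left, inner_leviCivita_frame_swap hV, frameCoord]
    simp
  have h2 : inner ℝ (leviCivita (𝓡 d) M (V a) m (X m)) (frame V k m)
      = ∑ i, frameCoord V X i m *
        inner ℝ (leviCivita (𝓡 d) M (V a) m (frame V i m)) (frame V k m) := by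
    conv_lhs => rw [← hX]
    simp only [map_sum, map_smul, sum_inner, inner_smul_left, frameCoord]
    simp
  rw [mvfderiv_frameCoord, h1, frameCoord, ← leviCivita_sub_eq_bracket, inner_sub_left, h2]
  have h3 : ∀ i, frameCoord V ⁅V a, frame V i⁆ k m
      = inner ℝ (leviCivita (𝓡 d) M (frame V i) m (V a m)) (frame V k m)
        - inner ℝ (leviCivita (𝓡 d) M (V a) m (frame V i m)) (frame V k m) := fun i => by
    rw [frameCoord, ← leviCivita_sub_eq_bracket, inner_sub_left]
  simp only [h3, mul_sub, Finset.sum_sub_distrib]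
  ring

/-- The Koszul formula for the frame `V`. -/
lemma inner_leviCivita_frame (i j k : Fin d) (m : M) :
    inner ℝ (leviCivita (𝓡 d) M (frame V i) m (frame V j m)) (frame V k m)
      = 2⁻¹ * (frameCoord V ⁅frame V j, frame V i⁆ k m - frameCoord V ⁅frame V j, frame V k⁆ i m
        - frameCoord V ⁅frame V i, frame V k⁆ j m) := by
  have h := inner_leviCivitaFun ((frame V j).mdifferentiableAt (x := m))
    ((frame V i).mdifferentiableAt (x := m)) ((frame V k).mdifferentiableAt (x := m))
  refine h.trans ?_
  have h0 : ∀ i k : Fin d, mvfderiv (𝓡 d) (fun x => inner ℝ (frame V i x) (frame V k x)) m = 0 :=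
    fun i k => by
      simp only [frame, hV]
      exact mvfderiv_const _
  simp only [koszul, h0]
  simp [frameCoord, bracket_apply]

section Bounded

variable {n : ℕ} (hc : ∀ (a : EuclideanSpace ℝ (Fin d)) (i k : Fin d),
  BoundedFieldDeriv V n (frameCoord V ⁅V a, frame V i⁆ k))

include hc

lemma exists_norm_leviCivita_frame_le (i : Fin d) :
    ∃ C : ℝ, ∀ (m : M) (v : TangentSpace (𝓡 d) m), ‖v‖ = 1 →
      ‖leviCivita (𝓡 d) M (frame V i) m v‖ ≤ C := by
  choose C hC using fun i j k : Fin d =>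
    (hc (EuclideanSpace.basisFun (Fin d) ℝ i) j k).exists_bound
  refine ⟨∑ k, ∑ j, 2⁻¹ * (C j i k + C j k i + C i k j), fun m v hv => ?_⟩
  refine (norm_le_sum_abs_inner_frame hV _).trans (Finset.sum_le_sum fun k _ => ?_)
  conv_lhs => rw [← sum_inner_frame_smul hV v]
  simp only [map_sum, map_smul, sum_inner, inner_smul_left]
  refine (Finset.abs_sum_le_sum_abs _ _).trans (Finset.sum_le_sum fun j _ => ?_)
  rw [inner_leviCivita_frame hV, abs_mul]
  have hv1 := abs_inner_frame_le hV v j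
  rw [hv] at hv1
  have hk : |2⁻¹ * (frameCoord V ⁅frame V j, frame V i⁆ k m
      - frameCoord V ⁅frame V j, frame V k⁆ i m - frameCoord V ⁅frame V i, frame V k⁆ j m)|
      ≤ 2⁻¹ * (C j i k + C j k i + C i k j) := by
    rw [abs_mul, abs_of_pos (by norm_num : (0 : ℝ) < 2⁻¹)]
    refine mul_le_mul_of_nonneg_left ?_ (by norm_num)
    exact (abs_sub _ _).trans (add_le_add ((abs_sub _ _).trans
      (add_le_add (hC j i k m) (hC j k i m))) (hC i k j m))
  exact (mul_le_of_le_one_left (abs_nonneg _) hv1).trans hk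

lemma covNorm_lt_top {X : Cₛ^∞⟮𝓡 d; EuclideanSpace ℝ (Fin d), fun x : M => TangentSpace (𝓡 d) x⟯}
    (hX : ∀ k, BoundedFieldDeriv V 1 (frameCoord V X k)) : covNorm X < ⊤ := by
  choose C hC using fun k => (hX k).exists_bound
  choose D hD using fun k j => ((hX k).2 (EuclideanSpace.basisFun (Fin d) ℝ j)).exists_bound
  choose N hN using exists_norm_leviCivita_frame_le hV hc
  refine lt_of_le_of_lt (iSup_le fun m => iSup₂_le fun v hv => ?_)
    (ENNReal.ofReal_lt_top (r := ∑ k, (∑ j, D k j + (∑ i, C i) * N k)))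
  rw [← ofReal_norm]
  refine ENNReal.ofReal_le_ofReal ((norm_le_sum_abs_inner_frame hV _).trans
    (Finset.sum_le_sum fun k _ => ?_))
  rw [eq_sub_of_add_eq (mvfderiv_frameCoord (V := V) X k m v).symm]
  refine (abs_sub _ _).trans (add_le_add ?_ ?_)
  · conv_lhs => rw [← sum_inner_frame_smul hV v]
    simp only [map_sum, map_smul]
    refine (Finset.abs_sum_le_sum_abs _ _).trans (Finset.sum_le_sum fun j _ => ?_)
    have hv1 := abs_inner_frame_le hV v j
    rw [hv] at hv1
    rw [smul_eq_mul, abs_mul]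
    exact (mul_le_of_le_one_left (abs_nonneg _) hv1).trans (hD k j m)
  · have hXm : ‖X m‖ ≤ ∑ i, C i := (norm_le_sum_abs_inner_frame hV _).trans
      (Finset.sum_le_sum fun k _ => hC k m)
    exact (abs_real_inner_le_norm _ _).trans (mul_le_mul hXm (hN k m v hv) (norm_nonneg _)
      ((norm_nonneg _).trans hXm))

/-- The components of a right-nested bracket of length `j ≥ 1` have bounded derivatives up to
order `n + 2 - j`. -/
lemma boundedFieldDeriv_nestedBracket (l : List (EuclideanSpace ℝ (Fin d)))
    (u : EuclideanSpace ℝ (Fin d)) (hl : l.length ≤ n) (k : Fin d) :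
    BoundedFieldDeriv V (n + 1 - l.length) (frameCoord V (nestedBracket V l u) k) := by
  induction l generalizing k with
  | nil =>
    change BoundedFieldDeriv V _ (frameCoord V (V u) k)
    rw [frameCoord_apply hV]
    exact .const _ _
  | cons a l ih =>
    rw [List.length_cons] at hl ⊢
    change BoundedFieldDeriv V _ (frameCoord V ⁅V a, nestedBracket V l u⁆ k)
    rw [funext (frameCoord_bracket hV a (nestedBracket V l u) k)]
    refine .add ?_ (.sum _ fun i _ => .mul ?_ ?_)
    · have h := ih (by omega) k
      rw [Nat.sub_add_comm (by omega : l.length ≤ n)] at h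
      exact (h.2 a).mono (by omega)
    · exact (ih (by omega) i).mono (by omega)
    · exact (hc a i k).mono (by omega)

end Bounded

end Frame

end RoughFlow

end

theorem proposition10p35 {d κ : ℕ} (hκ : 1 ≤ κ)
    {M : Type*} [EMetricSpace M] [ChartedSpace (EuclideanSpace ℝ (Fin d)) M]
    [IsManifold (𝓡 d) ∞ M]
    [Bundle.RiemannianBundle (fun x : M => TangentSpace (𝓡 d) x)]
    [IsContMDiffRiemannianBundle (𝓡 d) ∞ (EuclideanSpace ℝ (Fin d))
      (fun x : M => TangentSpace (𝓡 d) x)]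
    [IsRiemannianManifold (𝓡 d) M] [CompleteSpace M]
    (V : EuclideanSpace ℝ (Fin d) →ₗ[ℝ]
      Cₛ^∞⟮𝓡 d; EuclideanSpace ℝ (Fin d), fun x : M => TangentSpace (𝓡 d) x⟯)
    (hV : ∀ (a b : EuclideanSpace ℝ (Fin d)) (m : M), inner ℝ (V a m) (V b m) = inner ℝ a b)
    (Q : EuclideanSpace ℝ (Fin d) → EuclideanSpace ℝ (Fin d) → M → EuclideanSpace ℝ (Fin d))
    (hQ : ∀ (a b : EuclideanSpace ℝ (Fin d)) (m : M), ⁅V a, V b⁆ m = V (Q a b m) m)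
    (hbdd : ∀ (a b : EuclideanSpace ℝ (Fin d)) (l : List (EuclideanSpace ℝ (Fin d))),
      l.length ≤ κ - 1 → ∃ C : ℝ, ∀ m : M,
        ‖RoughFlow.iteratedFieldDeriv (I := 𝓡 d) (fun c x => V c x) l (Q a b) m‖ ≤ C) :
    RoughFlow.GlobalExistenceHypotheses κ V := by
  have hcoord : ∀ a (i k : Fin d), RoughFlow.frameCoord V ⁅V a, RoughFlow.frame V i⁆ k
      = fun m => Q a (EuclideanSpace.basisFun (Fin d) ℝ i) m k := fun a i k => by
    funext m
    rw [RoughFlow.frameCoord, RoughFlow.frame, hQ, RoughFlow.frame, hV]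
    simp [PiLp.inner_apply, EuclideanSpace.basisFun_apply]
  have hsmooth : ∀ a (i : Fin d), ContMDiff (𝓡 d) 𝓘(ℝ, EuclideanSpace ℝ (Fin d)) ∞
      (Q a (EuclideanSpace.basisFun (Fin d) ℝ i)) := fun a i => by
    have h : ContMDiff (𝓡 d) 𝓘(ℝ, Fin d → ℝ) ∞
        fun m k => Q a (EuclideanSpace.basisFun (Fin d) ℝ i) m k :=
      contMDiff_pi_space.2 fun k => hcoord a i k ▸ RoughFlow.contMDiff_frameCoord _ k
    exact (PiLp.contDiff_toLp (p := 2)).contMDiff.comp h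
  have hc : ∀ a (i k : Fin d), RoughFlow.BoundedFieldDeriv V (κ - 1)
      (RoughFlow.frameCoord V ⁅V a, RoughFlow.frame V i⁆ k) := fun a i k => by
    refine .of_iteratedFieldDeriv (RoughFlow.contMDiff_frameCoord _ k) fun l hl => ?_
    obtain ⟨C, hC⟩ := hbdd a (EuclideanSpace.basisFun (Fin d) ℝ i) l hl
    refine ⟨C, fun m => ?_⟩
    rw [hcoord]
    have h := congrFun (RoughFlow.iteratedFieldDeriv_clm_comp (V := V)
      (EuclideanSpace.proj k : EuclideanSpace ℝ (Fin d) →L[ℝ] ℝ) (hsmooth a i) l) m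
    exact (congrArg abs h).le.trans ((PiLp.norm_apply_le _ k).trans (hC m))
  have hnested : ∀ (l : List (EuclideanSpace ℝ (Fin d))) (u : EuclideanSpace ℝ (Fin d)),
      l.length + 1 ≤ κ → ∀ k, RoughFlow.BoundedFieldDeriv V 1
        (RoughFlow.frameCoord V (RoughFlow.nestedBracket V l u) k) := fun l u hl k =>
    (RoughFlow.boundedFieldDeriv_nestedBracket hV hc l u (by omega) k).mono (by omega)
  refine ⟨inferInstance, ENNReal.add_lt_top.2 ⟨?_, ?_⟩⟩
  · exact RoughFlow.iSup_nilpotentExtension_lt_top V RoughFlow.fieldNorm RoughFlow.fieldNorm_zero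
      RoughFlow.fieldNorm_add_le RoughFlow.fieldNorm_smul_le fun l u hl =>
        RoughFlow.fieldNorm_lt_top hV fun k => (hnested l u hl k).exists_bound
  · exact RoughFlow.iSup_nilpotentExtension_lt_top V RoughFlow.covNorm RoughFlow.covNorm_zero
      RoughFlow.covNorm_add_le RoughFlow.covNorm_smul_le fun l u hl =>
        RoughFlow.covNorm_lt_top hV hc (hnested l u hl)
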